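/- Let $(X,d)$ be a complete separable metric space with its Borel $\sigma$-algebra, and let $m=(m_x)_{x\in X}$ be a random walk on $X$: a family of probability measures on $X$ depending measurably on $x$, each with finite first moment. Let $\nu$ be an invariant probability measure of the walk that is reversible, i.e. $d\nu(x)\,dm_x(y)=d\nu(y)\,dm_y(x)$. Let $\kappa>0$ and suppose that the Ricci curvature of $(X,d,m)$ is at least $\kappa$, i.e. $$\kappa(x,y):=1-\frac{\mathcal T_1(m_x,m_y)}{d(x,y)}\ \ge\ \kappa\qquad\text{for all } x\neq y,$$ where $\mathcal T_1(\mu_1,\mu_2)=\inf_\xi\int d(x,y)\,d\xi(x,y)$, the infimum being over all measures $\xi$ on $X\times X$ projecting to $\mu_1$ and $\mu_2$. Suppose also that the average spread is finite: $$\sigma^2:=\int \frac12\iint d(y,z)^2\,dm_x(y)\,dm_x(z)\,d\nu(x)<\infty .$$ Let $Mf(x)=\int f\,dm_x$ and $\Delta=M-\mathrm{Id}$; these act as bounded operators on the real space $L^2(X,\nu)$ and on its quotient $L^2(X,\nu)/\{\mathrm{const}\}$ by the constant functions. Then: (1) the spectrum of $-\Delta$ on $L^2(X,\nu)/\{\mathrm{const}\}$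 is contained in $[\kappa,\infty)$ (in particular every eigenvalue of $-\Delta$ there is at least $\kappa$); (2) for every $f\in L^2(X,\nu)$ one has $f\in L^2(X,m_x)$ for $\nu$-almost every $x$, the function $x\mapsto\operatorname{Var}_{m_x}f$ is $\nu$-integrable, and $$\operatorname{Var}_\nu f\le\frac{1}{\kappa(2-\kappa)}\int\operatorname{Var}_{m_x}f\,d\nu(x);$$ (3) for every $f\in L^2(X,\nu)$ the function $(x,y)\mapsto (f(y)-f(x))^2$ is integrable for $d\nu(x)\,dm_x(y)$, and $$\operatorname{Var}_\nu f\le\frac{1}{2\kappa}\iint (f(y)-f(x))^2\,d\nu(x)\,dm_x(y).$$ (If $X$ has at least two points, the hypotheses force $\kappa\le 1$. If $X$ is a single point, both sides of the inequalities are $0$, with the convention $1/0=0$ when $\kappa=2$.) -/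

import Mathlib

open MeasureTheory ProbabilityTheory
open scoped ENNReal

/-- A random walk on a metric space `X`: a measurable family of probability measures
`m x` on `X` (a Markov kernel), each with finite first moment. -/
structure RandomWalk (X : Type*) [MetricSpace X] [MeasurableSpace X] where
  /-- the family of transition probabilities `m x` -/
  kernel : Kernel X X
  isMarkovKernel : IsMarkovKernel kernel
  finite_first_moment : ∀ x : X, ∃ o : X, ∫⁻ y, edist o y ∂(kernel x) < ∞

attribute [instance] RandomWalk.isMarkovKernel

section Transport

variable {X : Type*} [MetricSpace X] [MeasurableSpace X]

/-- The `L¹` transportation distance: the infimum of `∫ d(x, y) dξ(x, y)` over all measures `ξ`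
on `X × X` whose two projections are `μ₁` and `μ₂`. -/
noncomputable def transportDist (μ₁ μ₂ : Measure X) : ℝ≥0∞ :=
  ⨅ ξ ∈ {ξ : Measure (X × X) | ξ.map Prod.fst = μ₁ ∧ ξ.map Prod.snd = μ₂},
    ∫⁻ p, edist p.1 p.2 ∂ξ

namespace RandomWalk

/-- The Ricci curvature `κ(x, y) = 1 - T₁(m x, m y) / d(x, y)` in the direction `(x, y)`, for
`x ≠ y`. The transportation distance is finite because `m x` and `m y` have finite first
moments. -/
noncomputable def ricci (m : RandomWalk X) (x y : X) : ℝ :=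
  1 - (transportDist (m.kernel x) (m.kernel y)).toReal / dist x y

/-- The Ricci curvature is at least `κ`: `κ(x, y) ≥ κ` for any two distinct points. -/
def RicciAtLeast (m : RandomWalk X) (κ : ℝ) : Prop :=
  ∀ x y : X, x ≠ y → κ ≤ m.ricci x y

/-- The spread at `x`: `σ(x) = (½ ∬ d(y, z)² dm_x(y) dm_x(z))^{1/2}`, in `[0, ∞]`. -/
noncomputable def spread (m : RandomWalk X) (x : X) : ℝ≥0∞ :=
  (2⁻¹ * ∫⁻ y, ∫⁻ z, edist y z ^ 2 ∂(m.kernel x) ∂(m.kernel x)) ^ (1 / 2 : ℝ)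

/-- The average spread `σ = ‖σ(x)‖_{L²(X, ν)}`, in `[0, ∞]`. -/
noncomputable def averageSpread (m : RandomWalk X) (ν : Measure X) : ℝ≥0∞ :=
  (∫⁻ x, m.spread x ^ 2 ∂ν) ^ (1 / 2 : ℝ)

end RandomWalk

end Transport

section Averaging

variable {X : Type*} [MeasurableSpace X]

/-- The averaging operator on functions: `Mf(x) = ∫ f(y) dm_x(y)`. -/
noncomputable def averaging (m : Kernel X X) (f : X → ℝ) (x : X) : ℝ :=
  ∫ y, f y ∂(m x)

variable {m : Kernel X X} {ν : Measure X}

/-- A property that holds `ν`-almost everywhere holds `m x`-almost everywhere for `ν`-almost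
every `x`. -/
theorem ae_ae_of_invariant (h : m.Invariant ν) {p : X → Prop} (hp : ∀ᵐ y ∂ν, p y) :
    ∀ᵐ x ∂ν, ∀ᵐ y ∂(m x), p y := by
  refine Measure.ae_ae_of_ae_comp ?_
  rwa [h.def]

theorem lintegral_lintegral_of_invariant (h : m.Invariant ν) {g : X → ℝ≥0∞}
    (hg : AEMeasurable g ν) : ∫⁻ x, ∫⁻ y, g y ∂(m x) ∂ν = ∫⁻ y, g y ∂ν := by
  have h1 := Measure.lintegral_bind (m := ν) (μ := m) (f := g) m.aemeasurable
    (by rwa [h.def])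
  rw [← h1, h.def]

/-- For `f ∈ L²(ν)` one has `f ∈ L²(m x)` for `ν`-almost every `x`. -/
theorem ae_memLp_of_invariant (h : m.Invariant ν) {f : X → ℝ} (hf : MemLp f 2 ν) :
    ∀ᵐ x ∂ν, MemLp f 2 (m x) := by
  have hg : AEMeasurable (fun y => ‖f y‖ₑ ^ 2) ν := hf.1.enorm.pow_const 2
  have hfin : ∫⁻ x, ∫⁻ y, ‖f y‖ₑ ^ 2 ∂(m x) ∂ν < ∞ := by
    rw [lintegral_lintegral_of_invariant h hg]
    have := lintegral_rpow_enorm_lt_top_of_eLpNorm_lt_top (by simp) (by simp) hf.2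
    simpa using this
  have hmeas : AEMeasurable (fun x => ∫⁻ y, ‖f y‖ₑ ^ 2 ∂(m x)) ν := by
    refine ⟨fun x => ∫⁻ y, ‖hf.1.mk f y‖ₑ ^ 2 ∂(m x), ?_, ?_⟩
    · exact (hf.1.stronglyMeasurable_mk.enorm.pow_const 2).lintegral_kernel
    · filter_upwards [ae_ae_of_invariant h hf.1.ae_eq_mk] with x hx
      exact lintegral_congr_ae (hx.mono fun y hy => by simp only [hy])
  filter_upwards [ae_lt_top' hmeas hfin.ne, ae_ae_of_invariant h hf.1.ae_eq_mk] with x hx hx'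
  refine ⟨⟨hf.1.mk f, hf.1.stronglyMeasurable_mk, hx'⟩, ?_⟩
  rw [eLpNorm_lt_top_iff_lintegral_rpow_enorm_lt_top (by simp) (by simp)]
  simpa using hx

theorem averaging_congr (h : m.Invariant ν) {f g : X → ℝ} (hfg : f =ᵐ[ν] g) :
    averaging m f =ᵐ[ν] averaging m g := by
  filter_upwards [ae_ae_of_invariant h hfg] with x hx
  exact integral_congr_ae hx

theorem aestronglyMeasurable_averaging (h : m.Invariant ν) {f : X → ℝ}
    (hf : AEStronglyMeasurable f ν) : AEStronglyMeasurable (averaging m f) ν :=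
  ⟨averaging m (hf.mk f), hf.stronglyMeasurable_mk.integral_kernel,
    averaging_congr h hf.ae_eq_mk⟩

/-- `M` does not increase the `L²(ν)`-norm. -/
theorem eLpNorm_averaging_le [IsMarkovKernel m] (h : m.Invariant ν) {f : X → ℝ}
    (hf : MemLp f 2 ν) : eLpNorm (averaging m f) 2 ν ≤ eLpNorm f 2 ν := by
  have key : ∫⁻ x, ‖averaging m f x‖ₑ ^ 2 ∂ν ≤ ∫⁻ y, ‖f y‖ₑ ^ 2 ∂ν := by
    rw [← lintegral_lintegral_of_invariant h (hf.1.enorm.pow_const 2)]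
    refine lintegral_mono_ae ?_
    filter_upwards [ae_memLp_of_invariant h hf] with x hx
    have h1 : ‖averaging m f x‖ₑ ≤ eLpNorm f 2 (m x) :=
      calc ‖averaging m f x‖ₑ ≤ ∫⁻ y, ‖f y‖ₑ ∂(m x) := enorm_integral_le_lintegral_enorm _
        _ = eLpNorm f 1 (m x) := eLpNorm_one_eq_lintegral_enorm.symm
        _ ≤ eLpNorm f 2 (m x) := eLpNorm_le_eLpNorm_of_exponent_le (by norm_num) hx.1
    calc ‖averaging m f x‖ₑ ^ 2 ≤ eLpNorm f 2 (m x) ^ 2 := by gcongr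
      _ = ∫⁻ y, ‖f y‖ₑ ^ 2 ∂(m x) := by
        rw [eLpNorm_eq_lintegral_rpow_enorm_toReal (by simp) (by simp), ← ENNReal.rpow_natCast,
          ← ENNReal.rpow_mul]
        simp
  rw [eLpNorm_eq_lintegral_rpow_enorm_toReal (by simp) (by simp),
    eLpNorm_eq_lintegral_rpow_enorm_toReal (by simp) (by simp)]
  refine ENNReal.rpow_le_rpow ?_ (by simp)
  simpa using key

theorem memLp_averaging [IsMarkovKernel m] (h : m.Invariant ν) {f : X → ℝ}
    (hf : MemLp f 2 ν) : MemLp (averaging m f) 2 ν :=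
  ⟨aestronglyMeasurable_averaging h hf.1, (eLpNorm_averaging_le h hf).trans_lt hf.2⟩

/-- The averaging operator `M` as a bounded operator on `L²(X, ν)`, for `ν` invariant. -/
noncomputable def averagingL2 (m : Kernel X X) [IsMarkovKernel m] (ν : Measure X)
    (h : m.Invariant ν) : Lp ℝ 2 ν →L[ℝ] Lp ℝ 2 ν :=
  LinearMap.mkContinuous
    { toFun := fun f => (memLp_averaging h (Lp.memLp f)).toLp (averaging m f)
      map_add' := by
        intro f g
        rw [← MemLp.toLp_add]
        refine MemLp.toLp_congr _ _ ?_
        filter_upwards [averaging_congr h (Lp.coeFn_add f g),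
          ae_memLp_of_invariant h (Lp.memLp f), ae_memLp_of_invariant h (Lp.memLp g)]
          with x hx hf hg
        rw [hx]
        exact integral_add (hf.integrable (by norm_num)) (hg.integrable (by norm_num))
      map_smul' := by
        intro c f
        rw [RingHom.id_apply, ← MemLp.toLp_const_smul]
        refine MemLp.toLp_congr _ _ ?_
        filter_upwards [averaging_congr h (Lp.coeFn_smul c f)] with x hx
        rw [hx]
        exact integral_const_mul c _ }
    1 (by
      intro f
      rw [one_mul, LinearMap.coe_mk, AddHom.coe_mk, Lp.norm_toLp, Lp.norm_def]
      exact ENNReal.toReal_mono (Lp.eLpNorm_ne_top f) (eLpNorm_averaging_le h (Lp.memLp f)))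

theorem coeFn_averagingL2 [IsMarkovKernel m] (h : m.Invariant ν) (f : Lp ℝ 2 ν) :
    averagingL2 m ν h f =ᵐ[ν] averaging m f :=
  MemLp.coeFn_toLp (memLp_averaging h (Lp.memLp f))

/-- The subspace of constant functions in `L²(X, ν)`. -/
noncomputable def constL2 (ν : Measure X) [IsFiniteMeasure ν] : Submodule ℝ (Lp ℝ 2 ν) :=
  LinearMap.range (Lp.constL 2 ν ℝ : ℝ →L[ℝ] Lp ℝ 2 ν).toLinearMap

/-- `M` maps constant functions to themselves. -/
theorem averagingL2_const [IsMarkovKernel m] [IsFiniteMeasure ν] (h : m.Invariant ν) (c : ℝ) :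
    averagingL2 m ν h (Lp.const 2 ν c) = Lp.const 2 ν c := by
  refine Lp.ext ?_
  filter_upwards [coeFn_averagingL2 h (Lp.const 2 ν c),
    averaging_congr h (Lp.coeFn_const (p := 2) (μ := ν) c),
    Lp.coeFn_const (p := 2) (μ := ν) c] with x h1 h2 h3
  rw [h1, h2, h3]
  simp [averaging]

/-- The bounded operator induced by `M` on `L²(X, ν)/{const}`. -/
noncomputable def averagingL2Const (m : Kernel X X) [IsMarkovKernel m] (ν : Measure X)
    [IsFiniteMeasure ν] (h : m.Invariant ν) :
    (Lp ℝ 2 ν ⧸ constL2 ν) →L[ℝ] (Lp ℝ 2 ν ⧸ constL2 ν) :=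
  (constL2 ν).liftQL ((constL2 ν).mkQL.comp (averagingL2 m ν h)) (by
    rintro _ ⟨c, rfl⟩
    have h1 : averagingL2 m ν h (Lp.const 2 ν c) ∈ constL2 ν := by
      rw [averagingL2_const]
      exact ⟨c, rfl⟩
    exact (Submodule.Quotient.mk_eq_zero _).2 h1)

/-- The Laplacian `Δ = M - Id` on `L²(X, ν)/{const}`. -/
noncomputable def laplacianL2Const (m : Kernel X X) [IsMarkovKernel m] (ν : Measure X)
    [IsFiniteMeasure ν] (h : m.Invariant ν) :
    (Lp ℝ 2 ν ⧸ constL2 ν) →L[ℝ] (Lp ℝ 2 ν ⧸ constL2 ν) :=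
  averagingL2Const m ν h - ContinuousLinearMap.id ℝ _

end Averaging

/-! ### Growth of iterates and geometric decay -/

open Filter Topology
open scoped NNReal

/-! Everything follows from one estimate: `M` contracts the norm of mean zero functions in L²(ν) by
1 - κ.

By the easy half of Kantorovich duality, curvature at least κ makes `M` contract Lipschitz constants
by 1 - κ. If g is L-Lipschitz then Var_{m_x} g ≤ L²σ(x)². Apply the decomposition Var_ν g = Var_ν Mg
+ ∫ Var_{m_x} g dν to Mⁿg: each step loses at most L²(1 - κ)^{2n}σ². Since Var_ν Mⁿg → 0, summing
gives Var_ν Mⁿg ≤ C(1 - κ)^{2n}, with C depending on g (`variance_iterate_averaging_le`).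

Reversibility makes `M` self-adjoint, so n ↦ ‖Mⁿv‖ is log-convex and the constant C can be discarded
(`norm_apply_le_of_norm_pow_apply_le`). Density of bounded Lipschitz functions extends the
contraction to L²(ν). The spectral bound is then a norm bound; (2) is the decomposition again, and
(3) is Cauchy–Schwarz in the Dirichlet form. -/

/-- Symmetry and Cauchy–Schwarz make the ratios ‖Tⁿ⁺¹v‖ / ‖Tⁿv‖ nondecreasing. If the first one
exceeded q, ‖Tⁿv‖ would outgrow C qⁿ, whatever C is. -/
theorem norm_apply_le_of_norm_pow_apply_le {H : Type*} [NormedAddCommGroup H]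
    [InnerProductSpace ℝ H] {T : H →L[ℝ] H} (hT : ∀ x y, inner ℝ (T x) y = inner ℝ x (T y))
    {v : H} {C q : ℝ} (hq : 0 ≤ q) (h : ∀ n : ℕ, ‖(T ^ n) v‖ ≤ C * q ^ n) :
    ‖T v‖ ≤ q * ‖v‖ := by
  by_contra! hlt
  have hTv : 0 < ‖T v‖ := (by positivity : 0 ≤ q * ‖v‖).trans_lt hlt
  have hv : 0 < ‖v‖ := by
    rw [norm_pos_iff]
    rintro rfl
    simp at hTv
  have hstep : ∀ n : ℕ, ‖(T ^ (n + 1)) v‖ ^ 2 ≤ ‖(T ^ n) v‖ * ‖(T ^ (n + 2)) v‖ := by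
    intro n
    have h1 : ∀ k, (T ^ (k + 1)) v = T ((T ^ k) v) := fun k => by rw [pow_succ']; rfl
    rw [← real_inner_self_eq_norm_sq, h1 (n + 1)]
    nth_rewrite 1 [h1 n]
    rw [hT]
    exact real_inner_le_norm _ _
  -- Positivity is carried through the induction because the step cancels ‖Tⁿv‖.
  have hratio : ∀ n : ℕ, 0 < ‖(T ^ n) v‖ ∧ ‖T v‖ * ‖(T ^ n) v‖ ≤ ‖(T ^ (n + 1)) v‖ * ‖v‖ := by
    intro n
    induction n with
    | zero => simpa using hv
    | succ n ih =>
      obtain ⟨h0, h1⟩ := ih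
      have hpos : 0 < ‖(T ^ (n + 1)) v‖ := by
        by_contra! hle
        nlinarith [mul_pos hTv h0, norm_nonneg ((T ^ (n + 1)) v)]
      refine ⟨hpos, ?_⟩
      have h2 := hstep n
      have h3 : (‖T v‖ * ‖(T ^ (n + 1)) v‖) * ‖(T ^ n) v‖
          ≤ (‖(T ^ (n + 2)) v‖ * ‖v‖) * ‖(T ^ n) v‖ :=
        calc _ = (‖T v‖ * ‖(T ^ n) v‖) * ‖(T ^ (n + 1)) v‖ := by ring
          _ ≤ (‖(T ^ (n + 1)) v‖ * ‖v‖) * ‖(T ^ (n + 1)) v‖ := by gcongr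
          _ = ‖(T ^ (n + 1)) v‖ ^ 2 * ‖v‖ := by ring
          _ ≤ (‖(T ^ n) v‖ * ‖(T ^ (n + 2)) v‖) * ‖v‖ := by gcongr
          _ = _ := by ring
      exact le_of_mul_le_mul_right h3 h0
  set r := ‖T v‖ / ‖v‖ with hr
  have hqr : q < r := by rwa [hr, lt_div_iff₀ hv]
  have hr0 : 0 < r := hq.trans_lt hqr
  have hgrow : ∀ n : ℕ, ‖v‖ * r ^ n ≤ ‖(T ^ n) v‖ := by
    intro n
    induction n with
    | zero => simp
    | succ n ih =>
      have h1 : r * ‖(T ^ n) v‖ ≤ ‖(T ^ (n + 1)) v‖ := by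
        rw [hr, div_mul_eq_mul_div, div_le_iff₀ hv]
        exact (hratio n).2
      calc ‖v‖ * r ^ (n + 1) = r * (‖v‖ * r ^ n) := by ring
        _ ≤ r * ‖(T ^ n) v‖ := by gcongr
        _ ≤ _ := h1
  have hlim : Tendsto (fun n : ℕ => C * (q / r) ^ n) atTop (𝓝 (C * 0)) :=
    (tendsto_pow_atTop_nhds_zero_of_lt_one (by positivity) (by rwa [div_lt_one hr0])).const_mul C
  rw [mul_zero] at hlim
  refine hv.not_ge (ge_of_tendsto' hlim fun n => ?_)
  rw [div_pow, mul_div_assoc', le_div_iff₀ (by positivity)]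
  exact (hgrow n).trans (h n)

/-- The tail of the geometric series bounds what remains to be lost: v n - C qⁿ / (1 - q) is
nondecreasing with limit 0. -/
theorem le_of_sub_succ_le_geometric {v : ℕ → ℝ} {C q : ℝ} (hq0 : 0 ≤ q) (hq : q < 1)
    (hv : Tendsto v atTop (𝓝 0)) (h : ∀ n, v n - v (n + 1) ≤ C * q ^ n) (n : ℕ) :
    v n ≤ C / (1 - q) * q ^ n := by
  have hmono : Monotone fun n => v n - C / (1 - q) * q ^ n := by
    refine monotone_nat_of_le_succ fun n => ?_
    have h1 : C / (1 - q) * q ^ n - C / (1 - q) * q ^ (n + 1) = C * q ^ n := by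
      have : 1 - q ≠ 0 := by linarith
      field_simp
      ring
    linarith [h n]
  have hlim : Tendsto (fun n => v n - C / (1 - q) * q ^ n) atTop (𝓝 (0 - C / (1 - q) * 0)) :=
    hv.sub ((tendsto_pow_atTop_nhds_zero_of_lt_one hq0 hq).const_mul _)
  have := hmono.ge_of_tendsto hlim n
  simp only [mul_zero, sub_zero] at this
  linarith

theorem ProbabilityTheory.covariance_congr {Ω : Type*} [MeasurableSpace Ω] {μ : Measure Ω}
    {f f' g g' : Ω → ℝ} (hf : f =ᵐ[μ] f') (hg : g =ᵐ[μ] g') : cov[f, g; μ] = cov[f', g'; μ] := by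
  rw [covariance, covariance, integral_congr_ae hf, integral_congr_ae hg]
  refine integral_congr_ae ?_
  filter_upwards [hf, hg] with x h1 h2
  rw [h1, h2]

/-! ### The averaging operator: variance decomposition, symmetry, centering -/

section Averaging

variable {X : Type*} [MeasurableSpace X] {m : Kernel X X} {ν : Measure X}

theorem measurePreserving_fst_compProd [IsMarkovKernel m] [SFinite ν] :
    MeasurePreserving Prod.fst (ν ⊗ₘ m) ν :=
  ⟨measurable_fst, Measure.fst_compProd ν m⟩

theorem measurePreserving_snd_compProd [IsMarkovKernel m] [SFinite ν] (h : m.Invariant ν) :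
    MeasurePreserving Prod.snd (ν ⊗ₘ m) ν :=
  ⟨measurable_snd, (Measure.snd_compProd ν m).trans h.def⟩

theorem integrable_averaging [IsMarkovKernel m] [SFinite ν] (h : m.Invariant ν) {f : X → ℝ}
    (hf : Integrable f ν) : Integrable (averaging m f) ν := by
  have hint := (measurePreserving_snd_compProd h).integrable_comp_of_integrable hf
  exact ((Measure.integrable_compProd_iff hint.1).1 hint).2.mono'
    (aestronglyMeasurable_averaging h hf.1) (ae_of_all _ fun x => norm_integral_le_integral_norm _)

theorem integral_averaging [IsMarkovKernel m] [SFinite ν] (h : m.Invariant ν) {f : X → ℝ}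
    (hf : Integrable f ν) : ∫ x, averaging m f x ∂ν = ∫ x, f x ∂ν := by
  have hmp := measurePreserving_snd_compProd h
  have hint := hmp.integrable_comp_of_integrable hf
  calc ∫ x, averaging m f x ∂ν = ∫ p, (f ∘ Prod.snd) p ∂(ν ⊗ₘ m) :=
        (Measure.integral_compProd hint).symm
    _ = ∫ x, f x ∂ν := by
      conv_rhs => rw [← hmp.map_eq]
      rw [integral_map measurable_snd.aemeasurable (by rw [hmp.map_eq]; exact hf.1)]
      rfl

theorem ae_variance_eq_averaging [IsMarkovKernel m] (h : m.Invariant ν) {f : X → ℝ}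
    (hf : MemLp f 2 ν) : ∀ᵐ x ∂ν,
      Var[f; m x] = averaging m (fun y => f y ^ 2) x - averaging m f x ^ 2 := by
  filter_upwards [ae_memLp_of_invariant h hf] with x hx
  rw [variance_eq_sub hx]
  rfl

theorem integrable_variance [IsMarkovKernel m] [SFinite ν] (h : m.Invariant ν)
    {f : X → ℝ} (hf : MemLp f 2 ν) : Integrable (fun x => Var[f; m x]) ν :=
  ((integrable_averaging h hf.integrable_sq).sub (memLp_averaging h hf).integrable_sq).congr
    ((ae_variance_eq_averaging h hf).mono fun _ hx => hx.symm)

/-- Decomposition of the variance along one step of an invariant Markov kernel. -/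
theorem variance_eq_variance_averaging_add [IsMarkovKernel m] [IsProbabilityMeasure ν]
    (h : m.Invariant ν) {f : X → ℝ} (hf : MemLp f 2 ν) :
    Var[f; ν] = Var[averaging m f; ν] + ∫ x, Var[f; m x] ∂ν := by
  have hMf := memLp_averaging h hf
  rw [integral_congr_ae (ae_variance_eq_averaging h hf),
    integral_sub (integrable_averaging h hf.integrable_sq) hMf.integrable_sq,
    integral_averaging h hf.integrable_sq, variance_eq_sub hf, variance_eq_sub hMf,
    integral_averaging h (hf.integrable one_le_two)]
  simp only [Pi.pow_apply]
  ring

theorem map_swap_compProd_of_isReversible [IsMarkovKernel m] [IsFiniteMeasure ν]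
    (h : m.IsReversible ν) : (ν ⊗ₘ m).map Prod.swap = ν ⊗ₘ m := by
  refine Measure.ext_prod fun {s t} hs ht => ?_
  rw [Measure.map_apply measurable_swap (hs.prod ht), Set.preimage_swap_prod,
    Measure.compProd_apply_prod ht hs, Measure.compProd_apply_prod hs ht]
  exact h ht hs

theorem integrable_mul_compProd [IsMarkovKernel m] [SFinite ν] (h : m.Invariant ν)
    {f g : X → ℝ} (hf : MemLp f 2 ν) (hg : MemLp g 2 ν) :
    Integrable (fun p : X × X => f p.1 * g p.2) (ν ⊗ₘ m) :=
  (hf.comp_measurePreserving measurePreserving_fst_compProd).integrable_mul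
    (hg.comp_measurePreserving (measurePreserving_snd_compProd h))

theorem integral_mul_compProd [IsMarkovKernel m] [SFinite ν] (h : m.Invariant ν)
    {f g : X → ℝ} (hf : MemLp f 2 ν) (hg : MemLp g 2 ν) :
    ∫ p, f p.1 * g p.2 ∂(ν ⊗ₘ m) = ∫ x, f x * averaging m g x ∂ν := by
  rw [Measure.integral_compProd (integrable_mul_compProd h hf hg)]
  simp only [integral_const_mul, averaging]

/-- Both sides integrate a product f ⊗ g or g ⊗ f against `ν ⊗ₘ m`, which is invariant under the
swap. -/
theorem integral_averaging_mul_comm [IsMarkovKernel m] [IsFiniteMeasure ν]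
    (h : m.Invariant ν) (hr : m.IsReversible ν) {f g : X → ℝ} (hf : MemLp f 2 ν)
    (hg : MemLp g 2 ν) :
    ∫ x, averaging m f x * g x ∂ν = ∫ x, f x * averaging m g x ∂ν := by
  rw [← integral_mul_compProd h hf hg]
  simp_rw [mul_comm (averaging m f _)]
  rw [← integral_mul_compProd h hg hf]
  have hint := integrable_mul_compProd h hg hf
  rw [← map_swap_compProd_of_isReversible hr] at hint
  conv_lhs => rw [← map_swap_compProd_of_isReversible hr]
  rw [integral_map measurable_swap.aemeasurable hint.1]
  simp [mul_comm]

theorem integrable_sq_sub_compProd [IsMarkovKernel m] [SFinite ν] (h : m.Invariant ν)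
    {f : X → ℝ} (hf : MemLp f 2 ν) :
    Integrable (fun p : X × X => (f p.2 - f p.1) ^ 2) (ν ⊗ₘ m) :=
  ((hf.comp_measurePreserving (measurePreserving_snd_compProd h)).sub
    (hf.comp_measurePreserving measurePreserving_fst_compProd)).integrable_sq

/-- Expand the square; by invariance both marginals of `ν ⊗ₘ m` are ν. -/
theorem integral_sq_sub_compProd [IsMarkovKernel m] [IsFiniteMeasure ν] (h : m.Invariant ν)
    {f : X → ℝ} (hf : MemLp f 2 ν) :
    ∫ x, ∫ y, (f y - f x) ^ 2 ∂(m x) ∂ν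
      = 2 * (∫ x, f x ^ 2 ∂ν - ∫ x, f x * averaging m f x ∂ν) := by
  rw [← Measure.integral_compProd (integrable_sq_sub_compProd h hf)]
  have h1 : Integrable (fun p : X × X => f p.1 ^ 2) (ν ⊗ₘ m) :=
    (hf.comp_measurePreserving measurePreserving_fst_compProd).integrable_sq
  have h2 : Integrable (fun p : X × X => f p.2 ^ 2) (ν ⊗ₘ m) :=
    (hf.comp_measurePreserving (measurePreserving_snd_compProd h)).integrable_sq
  have h3 := integrable_mul_compProd h hf hf
  have e : (fun p : X × X => (f p.2 - f p.1) ^ 2)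
      = fun p => (f p.1 ^ 2 + f p.2 ^ 2) - 2 * (f p.1 * f p.2) := by
    ext p; ring
  have hs : ∫ p, (f p.1 ^ 2 + f p.2 ^ 2) - 2 * (f p.1 * f p.2) ∂(ν ⊗ₘ m) = _ :=
    integral_sub (h1.add h2) (h3.const_mul 2)
  have ha : ∫ p, f p.1 ^ 2 + f p.2 ^ 2 ∂(ν ⊗ₘ m) = _ := integral_add h1 h2
  rw [e, hs, ha, integral_const_mul,
    integral_mul_compProd h hf hf]
  have e1 : ∫ p, f p.1 ^ 2 ∂(ν ⊗ₘ m) = ∫ x, f x ^ 2 ∂ν := by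
    have hmp := measurePreserving_fst_compProd (m := m) (ν := ν)
    rw [← hmp.map_eq, integral_map measurable_fst.aemeasurable
      (by rw [hmp.map_eq]; exact hf.1.pow 2), hmp.map_eq]
  have e2 : ∫ p, f p.2 ^ 2 ∂(ν ⊗ₘ m) = ∫ x, f x ^ 2 ∂ν := by
    have hmp := measurePreserving_snd_compProd h
    conv_rhs => rw [← hmp.map_eq]
    rw [integral_map measurable_snd.aemeasurable (by rw [hmp.map_eq]; exact hf.1.pow 2)]
  rw [e1, e2]
  ring

theorem inner_averagingL2_comm [IsMarkovKernel m] [IsFiniteMeasure ν]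
    (h : m.Invariant ν) (hr : m.IsReversible ν) (f g : Lp ℝ 2 ν) :
    inner ℝ (averagingL2 m ν h f) g = inner ℝ f (averagingL2 m ν h g) := by
  have e1 : inner ℝ (averagingL2 m ν h f) g = ∫ x, averaging m f x * g x ∂ν := by
    rw [L2.inner_def]
    refine integral_congr_ae ?_
    filter_upwards [coeFn_averagingL2 h f] with x hx
    rw [hx]
    simp [mul_comm]
  have e2 : inner ℝ f (averagingL2 m ν h g) = ∫ x, f x * averaging m g x ∂ν := by
    rw [L2.inner_def]
    refine integral_congr_ae ?_
    filter_upwards [coeFn_averagingL2 h g] with x hx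
    rw [hx]
    simp [mul_comm]
  rw [e1, e2, integral_averaging_mul_comm h hr (Lp.memLp f) (Lp.memLp g)]

variable [IsProbabilityMeasure ν]

/-- The orthogonal projection of `L²(ν)` onto the functions of mean zero. -/
noncomputable def centerL2 (ν : Measure X) [IsProbabilityMeasure ν] :
    Lp ℝ 2 ν →L[ℝ] Lp ℝ 2 ν :=
  ContinuousLinearMap.id ℝ _ - (Lp.constL 2 ν ℝ).comp (innerSL ℝ (Lp.const 2 ν (1 : ℝ)))

theorem centerL2_apply (f : Lp ℝ 2 ν) : centerL2 ν f = f - Lp.const 2 ν (∫ x, f x ∂ν) := by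
  have : inner ℝ (Lp.const 2 ν (1 : ℝ)) f = ∫ x, f x ∂ν := by
    rw [L2.inner_def]
    refine integral_congr_ae ?_
    filter_upwards [Lp.coeFn_const (p := 2) (μ := ν) (1 : ℝ)] with x hx
    rw [hx]
    simp
  simp [centerL2, this]

theorem coeFn_centerL2 (f : Lp ℝ 2 ν) : centerL2 ν f =ᵐ[ν] fun x => f x - ∫ y, f y ∂ν := by
  rw [centerL2_apply]
  filter_upwards [Lp.coeFn_sub f (Lp.const 2 ν (∫ x, f x ∂ν)),
    Lp.coeFn_const (p := 2) (μ := ν) (∫ x, f x ∂ν)] with x h1 h2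
  rw [h1, Pi.sub_apply, h2]
  rfl

theorem inner_centerL2 (f g : Lp ℝ 2 ν) :
    inner ℝ (centerL2 ν f) (centerL2 ν g) = cov[f, g; ν] := by
  rw [L2.inner_def, covariance]
  refine integral_congr_ae ?_
  filter_upwards [coeFn_centerL2 f, coeFn_centerL2 g] with x hf hg
  rw [hf, hg]
  simp [mul_comm]

theorem norm_centerL2_sq (f : Lp ℝ 2 ν) : ‖centerL2 ν f‖ ^ 2 = Var[f; ν] := by
  rw [← real_inner_self_eq_norm_sq, inner_centerL2,
    covariance_self (Lp.aestronglyMeasurable f).aemeasurable]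

theorem centerL2_averagingL2 [IsMarkovKernel m] (h : m.Invariant ν) (f : Lp ℝ 2 ν) :
    centerL2 ν (averagingL2 m ν h f) = averagingL2 m ν h (centerL2 ν f) := by
  rw [centerL2_apply, centerL2_apply, map_sub, averagingL2_const,
    integral_congr_ae (coeFn_averagingL2 h f),
    integral_averaging h ((Lp.memLp f).integrable one_le_two)]

theorem norm_centerL2_le_norm (f : Lp ℝ 2 ν) : ‖centerL2 ν f‖ ≤ ‖f‖ := by
  refine le_of_sq_le_sq ?_ (norm_nonneg _)
  rw [norm_centerL2_sq, ← real_inner_self_eq_norm_sq, L2.inner_def]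
  refine (variance_le_expectation_sq (Lp.aestronglyMeasurable f)).trans (le_of_eq ?_)
  simp [sq]

theorem centerL2_pow_averagingL2 [IsMarkovKernel m] (h : m.Invariant ν) (n : ℕ) (f : Lp ℝ 2 ν) :
    (averagingL2 m ν h ^ n) (centerL2 ν f) = centerL2 ν ((averagingL2 m ν h ^ n) f) := by
  induction n with
  | zero => simp
  | succ n ih =>
    rw [pow_succ', mul_apply_eq_comp, ih, mul_apply_eq_comp,
      centerL2_averagingL2]

end Averaging

/-! ### Bounded Lipschitz functions: density and variance -/

section BoundedLipschitz

variable {X : Type*} [MetricSpace X]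

/-- The function `g` is bounded and `L`-Lipschitz. -/
def IsBoundedLipschitz (L : ℝ≥0) (g : X → ℝ) : Prop :=
  LipschitzWith L g ∧ ∃ B : ℝ, ∀ x, |g x| ≤ B

variable [MeasurableSpace X] [BorelSpace X]

theorem IsBoundedLipschitz.measurable {L : ℝ≥0} {g : X → ℝ} (hg : IsBoundedLipschitz L g) :
    Measurable g :=
  hg.1.continuous.measurable

theorem IsBoundedLipschitz.memLp {L : ℝ≥0} {g : X → ℝ} (hg : IsBoundedLipschitz L g)
    (p : ℝ≥0∞) (μ : Measure X) [IsFiniteMeasure μ] : MemLp g p μ := by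
  obtain ⟨B, hB⟩ := hg.2
  exact MemLp.of_bound hg.measurable.aestronglyMeasurable B (ae_of_all _ hB)

theorem IsBoundedLipschitz.integrable {L : ℝ≥0} {g : X → ℝ} (hg : IsBoundedLipschitz L g)
    (μ : Measure X) [IsFiniteMeasure μ] : Integrable g μ :=
  memLp_one_iff_integrable.1 (hg.memLp 1 μ)

/-- The subspace of `L²(μ)` of classes of bounded Lipschitz functions. -/
def boundedLipschitzL2 (μ : Measure X) : Submodule ℝ (Lp ℝ 2 μ) where
  carrier := {f | ∃ L g, IsBoundedLipschitz L g ∧ f =ᵐ[μ] g}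
  add_mem' := by
    rintro f₁ f₂ ⟨L₁, g₁, ⟨hL₁, B₁, hB₁⟩, h₁⟩ ⟨L₂, g₂, ⟨hL₂, B₂, hB₂⟩, h₂⟩
    refine ⟨L₁ + L₂, g₁ + g₂, ⟨hL₁.add hL₂, B₁ + B₂, fun x => ?_⟩,
      (Lp.coeFn_add f₁ f₂).trans (h₁.add h₂)⟩
    exact (abs_add_le _ _).trans (add_le_add (hB₁ x) (hB₂ x))
  zero_mem' := ⟨0, 0, ⟨LipschitzWith.const 0, 0, by simp⟩, Lp.coeFn_zero _ _ _⟩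
  smul_mem' := by
    rintro c f ⟨L, g, ⟨hL, B, hB⟩, h⟩
    refine ⟨‖c‖₊ * L, c • g, ⟨(lipschitzWith_smul c).comp hL, |c| * B, fun x => ?_⟩,
      (Lp.coeFn_smul c f).trans (h.const_smul c)⟩
    rw [Pi.smul_apply, smul_eq_mul, abs_mul]
    exact mul_le_mul_of_nonneg_left (hB x) (abs_nonneg c)

/-- Bounded Lipschitz functions are dense in `L²`. -/
theorem dense_boundedLipschitzL2 (μ : Measure X) [IsFiniteMeasure μ] :
    Dense (boundedLipschitzL2 μ : Set (Lp ℝ 2 μ)) := by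
  rw [Submodule.dense_iff_topologicalClosure_eq_top, Submodule.topologicalClosure_eq_top_iff,
    Submodule.eq_bot_iff]
  intro f hf
  have hfi : Integrable f μ := (Lp.memLp f).integrable one_le_two
  refine (Lp.eq_zero_iff_ae_eq_zero).2 (ae_eq_zero_of_forall_setIntegral_isClosed_eq_zero hfi
    fun F hF => ?_)
  -- Thickened indicators of F are bounded Lipschitz, hence orthogonal to f, and converge pointwise
  -- to the indicator of F.
  let δ : ℕ → ℝ := fun n => 1 / ((n : ℝ) + 1)
  have δpos : ∀ n, 0 < δ n := fun n => Nat.one_div_pos_of_nat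
  let g : ℕ → X → ℝ := fun n x => (thickenedIndicator (δpos n) F x : ℝ)
  have hg1 : ∀ n x, |g n x| ≤ 1 := fun n x => by
    rw [abs_of_nonneg (NNReal.coe_nonneg _)]
    exact_mod_cast thickenedIndicator_le_one (δpos n) F x
  have hg : ∀ n, IsBoundedLipschitz (δ n).toNNReal⁻¹ (g n) := fun n =>
    ⟨LipschitzWith.of_dist_le_mul fun x y =>
      (lipschitzWith_thickenedIndicator (δpos n) F).dist_le_mul x y, 1, hg1 n⟩
  have hzero : ∀ n, ∫ x, g n x * f x ∂μ = 0 := fun n => by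
    have h1 : ((hg n).memLp 2 μ).toLp (g n) ∈ boundedLipschitzL2 μ :=
      ⟨_, g n, hg n, MemLp.coeFn_toLp _⟩
    have h2 := (Submodule.mem_orthogonal _ _).1 hf _ h1
    rw [L2.inner_def] at h2
    rw [← h2]
    refine integral_congr_ae ?_
    filter_upwards [((hg n).memLp 2 μ).coeFn_toLp] with x hx
    rw [hx]
    simp [mul_comm]
  have hlim : Tendsto (fun n => ∫ x, g n x * f x ∂μ) atTop
      (𝓝 (∫ x, F.indicator (fun _ => (1 : ℝ)) x * f x ∂μ)) := by
    refine tendsto_integral_of_dominated_convergence (fun x => ‖f x‖)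
      (fun n => (hg n).measurable.aestronglyMeasurable.mul hfi.1) hfi.norm
      (fun n => ae_of_all _ fun x => ?_) (ae_of_all _ fun x => ?_)
    · rw [norm_mul]
      exact mul_le_of_le_one_left (norm_nonneg _) (hg1 n x)
    · refine Tendsto.mul_const _ ?_
      have h1 := tendsto_pi_nhds.1 (thickenedIndicator_tendsto_indicator_closure δpos
        tendsto_one_div_add_atTop_nhds_zero_nat F) x
      rw [hF.closure_eq] at h1
      have h2 := (NNReal.continuous_coe.tendsto _).comp h1
      have e : F.indicator (fun _ => (1 : ℝ)) x = (F.indicator (fun _ => (1 : ℝ≥0)) x : ℝ≥0) := by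
        by_cases hx : x ∈ F <;> simp [hx]
      rw [e]
      exact h2
  simp_rw [hzero] at hlim
  rw [tendsto_const_nhds_iff] at hlim
  rw [← integral_indicator hF.measurableSet, hlim]
  refine integral_congr_ae (ae_of_all _ fun x => ?_)
  by_cases hx : x ∈ F <;> simp [hx]

/-- The variance is at most the second moment about g n x₀, which vanishes by dominated convergence.
The uniform bound B stands in for a moment condition on μ. -/
theorem tendsto_variance_zero_of_lipschitz [Nonempty X] (μ : Measure X) [IsProbabilityMeasure μ]
    {g : ℕ → X → ℝ} {L : ℕ → ℝ≥0} {B : ℝ} (hg : ∀ n, LipschitzWith (L n) (g n))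
    (hB : ∀ n x, |g n x| ≤ B) (hL : Tendsto L atTop (𝓝 0)) :
    Tendsto (fun n => Var[g n; μ]) atTop (𝓝 0) := by
  obtain ⟨x₀⟩ := ‹Nonempty X›
  have hm : ∀ n, AEStronglyMeasurable (g n) μ := fun n =>
    (hg n).continuous.measurable.aestronglyMeasurable
  have hlim : Tendsto (fun n => ∫ x, (g n x - g n x₀) ^ 2 ∂μ) atTop (𝓝 (∫ _, (0 : ℝ) ∂μ)) := by
    refine tendsto_integral_of_dominated_convergence (fun _ => (2 * B) ^ 2)
      (fun n => ((hm n).sub aestronglyMeasurable_const).pow 2) (integrable_const _)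
      (fun n => ae_of_all _ fun x => ?_) (ae_of_all _ fun x => ?_)
    · rw [norm_pow, Real.norm_eq_abs]
      gcongr
      exact (abs_sub _ _).trans (by linarith [hB n x, hB n x₀])
    · have h1 : Tendsto (fun n => (L n : ℝ) * dist x x₀) atTop (𝓝 (0 * dist x x₀)) :=
        ((NNReal.continuous_coe.tendsto _).comp hL).mul_const _
      rw [zero_mul] at h1
      have h2 : Tendsto (fun n => g n x - g n x₀) atTop (𝓝 0) :=
        squeeze_zero_norm (fun n => by
          rw [← dist_eq_norm]
          exact (hg n).dist_le_mul x x₀) h1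
      simpa using h2.pow 2
  rw [integral_zero] at hlim
  refine squeeze_zero (fun n => variance_nonneg _ _) (fun n => ?_) hlim
  rw [← variance_sub_const (hm n) (g n x₀)]
  exact variance_le_expectation_sq ((hm n).sub aestronglyMeasurable_const)

theorem IsBoundedLipschitz.integral_integral_sq_sub {L : ℝ≥0} {g : X → ℝ}
    (hg : IsBoundedLipschitz L g) (μ : Measure X) [IsProbabilityMeasure μ] :
    ∫ y, ∫ z, (g y - g z) ^ 2 ∂μ ∂μ = 2 * Var[g; μ] := by
  have h2 := (hg.memLp 2 μ).integrable_sq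
  have h1 := hg.integrable μ
  have e : ∀ y, ∫ z, (g y - g z) ^ 2 ∂μ = g y ^ 2 - 2 * g y * (∫ z, g z ∂μ) + ∫ z, g z ^ 2 ∂μ := by
    intro y
    simp_rw [sub_sq]
    have ha : ∫ z, g y ^ 2 - 2 * g y * g z + g z ^ 2 ∂μ = _ :=
      integral_add ((integrable_const _).sub (h1.const_mul _)) h2
    rw [ha, integral_sub (integrable_const _) (h1.const_mul _), integral_const_mul]
    simp
  simp_rw [e]
  have e2 : ∀ y, 2 * g y * (∫ z, g z ∂μ) = (2 * ∫ z, g z ∂μ) * g y := fun y => by ring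
  simp_rw [e2]
  have ha : ∫ y, g y ^ 2 - (2 * ∫ z, g z ∂μ) * g y + ∫ z, g z ^ 2 ∂μ ∂μ = _ :=
    integral_add (h2.sub (h1.const_mul _)) (integrable_const _)
  rw [ha, integral_sub h2 (h1.const_mul _), integral_const_mul, variance_eq_sub (hg.memLp 2 μ)]
  simp only [Pi.pow_apply, integral_const, probReal_univ, one_smul]
  ring

/-- The variance is half the mean squared difference of two independent samples, whence the ½ in the
spread. The bound lives in `ℝ≥0∞`, as the spread may be infinite at some points. -/
theorem IsBoundedLipschitz.ofReal_variance_le {L : ℝ≥0} {g : X → ℝ}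
    (hg : IsBoundedLipschitz L g) (μ : Measure X) [IsProbabilityMeasure μ] :
    ENNReal.ofReal Var[g; μ] ≤ L ^ 2 * (2⁻¹ * ∫⁻ y, ∫⁻ z, edist y z ^ 2 ∂μ ∂μ) := by
  have hle : ∀ y z, ‖(g y - g z) ^ 2‖ₑ ≤ (L : ℝ≥0∞) ^ 2 * edist y z ^ 2 := fun y z => by
    rw [enorm_pow, ← mul_pow, ← edist_eq_enorm_sub]
    gcongr
    exact hg.1 y z
  have key : ENNReal.ofReal (2 * Var[g; μ]) ≤ L ^ 2 * ∫⁻ y, ∫⁻ z, edist y z ^ 2 ∂μ ∂μ := by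
    rw [← hg.integral_integral_sq_sub μ]
    refine (Real.ofReal_le_enorm _).trans ((enorm_integral_le_lintegral_enorm _).trans ?_)
    rw [← lintegral_const_mul' _ _ (by simp)]
    refine lintegral_mono fun y => (enorm_integral_le_lintegral_enorm _).trans ?_
    rw [← lintegral_const_mul' _ _ (by simp)]
    exact lintegral_mono fun z => hle y z
  have h2 : ENNReal.ofReal Var[g; μ] = 2⁻¹ * ENNReal.ofReal (2 * Var[g; μ]) := by
    rw [ENNReal.ofReal_mul zero_le_two, ← mul_assoc]
    norm_num [ENNReal.inv_mul_cancel]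
  rw [h2, mul_left_comm]
  gcongr

end BoundedLipschitz

/-! ### Iterates of the averaging operator -/

section Averaging

theorem abs_averaging_le {X : Type*} [MeasurableSpace X] {m : Kernel X X} [IsMarkovKernel m]
    {g : X → ℝ} {B : ℝ} (hB : ∀ x, |g x| ≤ B) (x : X) : |averaging m g x| ≤ B := by
  have := norm_integral_le_of_norm_le_const (f := g) (μ := m x) (ae_of_all _ hB)
  rwa [probReal_univ, mul_one] at this

theorem averagingL2_pow_ae_eq {X : Type*} [MeasurableSpace X] {m : Kernel X X}
    [IsMarkovKernel m] {ν : Measure X} (hinv : m.Invariant ν) {f : Lp ℝ 2 ν} {g : X → ℝ}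
    (hfg : f =ᵐ[ν] g) (n : ℕ) :
    ((averagingL2 m ν hinv) ^ n) f =ᵐ[ν] (averaging m)^[n] g := by
  induction n with
  | zero => simpa using hfg
  | succ n ih =>
    rw [pow_succ', mul_apply_eq_comp, Function.iterate_succ_apply']
    exact (coeFn_averagingL2 hinv _).trans (averaging_congr hinv ih)

end Averaging

/-! ### Transport distance and Lipschitz functions -/

section Transport

variable {X : Type*} [MetricSpace X] [MeasurableSpace X] [BorelSpace X]

/-- The easy half of the Kantorovich duality. -/
theorem IsBoundedLipschitz.edist_integral_le {L : ℝ≥0} {g : X → ℝ} (hg : IsBoundedLipschitz L g)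
    (μ₁ μ₂ : Measure X) [IsProbabilityMeasure μ₁] [IsProbabilityMeasure μ₂] :
    edist (∫ y, g y ∂μ₁) (∫ y, g y ∂μ₂) ≤ L * transportDist μ₁ μ₂ := by
  -- Moving the factor L inside the infimum requires, when L = 0, that a coupling exist: the product
  -- measure.
  rw [transportDist, iInf_subtype', ENNReal.mul_iInf' (by simp)
    fun _ => ⟨μ₁.prod μ₂, by simp, by simp⟩]
  refine le_iInf ?_
  rintro ⟨ξ, h1, h2⟩
  -- Couplings are arbitrary measures; the first marginal forces total mass 1.
  have : IsFiniteMeasure ξ := by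
    refine ⟨?_⟩
    have h3 : ξ.map Prod.fst Set.univ = 1 := by rw [h1, measure_univ]
    rw [Measure.map_apply measurable_fst MeasurableSet.univ, Set.preimage_univ] at h3
    rw [h3]
    exact ENNReal.one_lt_top
  have i1 : Integrable (fun p : X × X => g p.1) ξ := by
    have := hg.integrable μ₁
    rw [← h1] at this
    exact this.comp_measurable measurable_fst
  have i2 : Integrable (fun p : X × X => g p.2) ξ := by
    have := hg.integrable μ₂
    rw [← h2] at this
    exact this.comp_measurable measurable_snd
  have e1 : ∫ y, g y ∂μ₁ = ∫ p, g p.1 ∂ξ := by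
    rw [← h1, integral_map measurable_fst.aemeasurable hg.measurable.aestronglyMeasurable]
  have e2 : ∫ y, g y ∂μ₂ = ∫ p, g p.2 ∂ξ := by
    rw [← h2, integral_map measurable_snd.aemeasurable hg.measurable.aestronglyMeasurable]
  rw [edist_eq_enorm_sub, e1, e2, ← integral_sub i1 i2]
  refine (enorm_integral_le_lintegral_enorm _).trans ?_
  rw [← lintegral_const_mul' _ _ (by simp)]
  refine lintegral_mono fun p => ?_
  rw [← edist_eq_enorm_sub]
  exact hg.1 p.1 p.2

/-- The product coupling has finite cost. This matters because `ricci` uses `toReal`, which would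
send an infinite distance to 0. -/
theorem transportDist_lt_top [SecondCountableTopology X] (μ₁ μ₂ : Measure X)
    [IsProbabilityMeasure μ₁] [IsProbabilityMeasure μ₂]
    (h₁ : ∃ o, ∫⁻ y, edist o y ∂μ₁ < ∞) (h₂ : ∃ o, ∫⁻ y, edist o y ∂μ₂ < ∞) :
    transportDist μ₁ μ₂ < ∞ := by
  obtain ⟨o₁, h₁⟩ := h₁
  obtain ⟨o₂, h₂⟩ := h₂
  have hmem : μ₁.prod μ₂ ∈
      {ξ : Measure (X × X) | ξ.map Prod.fst = μ₁ ∧ ξ.map Prod.snd = μ₂} := ⟨by simp, by simp⟩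
  refine (iInf₂_le _ hmem).trans_lt ?_
  calc ∫⁻ p, edist p.1 p.2 ∂(μ₁.prod μ₂)
      ≤ ∫⁻ p, (edist o₁ p.1 + (edist o₁ o₂ + edist o₂ p.2)) ∂(μ₁.prod μ₂) := by
        refine lintegral_mono fun p => ?_
        refine (edist_triangle_left p.1 p.2 o₁).trans ?_
        gcongr
        exact edist_triangle _ _ _
    _ = ∫⁻ y, edist o₁ y ∂μ₁ + (edist o₁ o₂ + ∫⁻ y, edist o₂ y ∂μ₂) := by
        rw [lintegral_add_left (by fun_prop), lintegral_add_left (by fun_prop),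
          lintegral_const, measure_univ, mul_one,
          lintegral_prod _ (by fun_prop), lintegral_prod _ (by fun_prop)]
        simp
    _ < ∞ := by
        simp only [ENNReal.add_lt_top]
        exact ⟨h₁, edist_lt_top _ _, h₂⟩

end Transport

/-! ### Contraction in positive curvature -/

namespace RandomWalk

variable {X : Type*} [MetricSpace X] [MeasurableSpace X]

theorem RicciAtLeast.le_one [Nontrivial X] {m : RandomWalk X} {κ : ℝ} (h : m.RicciAtLeast κ) :
    κ ≤ 1 := by
  obtain ⟨x, y, hxy⟩ := exists_pair_ne X
  refine (h x y hxy).trans ?_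
  rw [ricci, sub_le_self_iff]
  positivity

theorem spread_sq (m : RandomWalk X) (x : X) :
    m.spread x ^ 2 = 2⁻¹ * ∫⁻ y, ∫⁻ z, edist y z ^ 2 ∂(m.kernel x) ∂(m.kernel x) := by
  rw [spread, ← ENNReal.rpow_natCast, ← ENNReal.rpow_mul]
  norm_num

theorem lintegral_spread_sq_lt_top {m : RandomWalk X} {ν : Measure X}
    (h : m.averageSpread ν < ∞) : ∫⁻ x, m.spread x ^ 2 ∂ν < ∞ := by
  rwa [averageSpread, ENNReal.rpow_lt_top_iff_of_pos (by norm_num)] at h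

variable [BorelSpace X] [SecondCountableTopology X]

theorem RicciAtLeast.transportDist_le {m : RandomWalk X} {κ : ℝ} (h : m.RicciAtLeast κ)
    {x y : X} (hxy : x ≠ y) :
    transportDist (m.kernel x) (m.kernel y) ≤ (1 - κ).toNNReal * edist x y := by
  have hfin := transportDist_lt_top (m.kernel x) (m.kernel y) (m.finite_first_moment x)
    (m.finite_first_moment y)
  have h1 := h x y hxy
  rw [ricci, le_sub_comm, div_le_iff₀ (dist_pos.2 hxy)] at h1
  rw [← ENNReal.ofReal_toReal hfin.ne, edist_dist, ← ENNReal.ofReal,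
    ← ENNReal.ofReal_mul' dist_nonneg]
  exact ENNReal.ofReal_le_ofReal h1

/-- Positive curvature: averaging contracts Lipschitz constants by `1 - κ`. -/
theorem RicciAtLeast.isBoundedLipschitz_averaging {m : RandomWalk X} {κ : ℝ}
    (h : m.RicciAtLeast κ) {L : ℝ≥0} {g : X → ℝ} (hg : IsBoundedLipschitz L g) :
    IsBoundedLipschitz (L * (1 - κ).toNNReal) (averaging m.kernel g) := by
  refine ⟨fun x y => ?_, ?_⟩
  · rcases eq_or_ne x y with rfl | hxy
    · simp
    · refine (hg.edist_integral_le (m.kernel x) (m.kernel y)).trans ?_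
      rw [ENNReal.coe_mul, mul_assoc]
      gcongr
      exact h.transportDist_le hxy
  · obtain ⟨B, hB⟩ := hg.2
    exact ⟨B, fun x => abs_averaging_le hB x⟩

theorem RicciAtLeast.isBoundedLipschitz_iterate {m : RandomWalk X} {κ : ℝ}
    (h : m.RicciAtLeast κ) {L : ℝ≥0} {g : X → ℝ} (hg : IsBoundedLipschitz L g) (n : ℕ) :
    IsBoundedLipschitz (L * (1 - κ).toNNReal ^ n) ((averaging m.kernel)^[n] g) := by
  induction n with
  | zero => simpa using hg
  | succ n ih =>
    rw [Function.iterate_succ_apply', pow_succ, ← mul_assoc]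
    exact h.isBoundedLipschitz_averaging ih

variable {m : RandomWalk X} {ν : Measure X} [IsProbabilityMeasure ν]

theorem integral_variance_le (hinv : m.kernel.Invariant ν) (hσ : m.averageSpread ν < ∞)
    {L : ℝ≥0} {g : X → ℝ} (hg : IsBoundedLipschitz L g) :
    ∫ x, Var[g; m.kernel x] ∂ν ≤ (L : ℝ) ^ 2 * (∫⁻ x, m.spread x ^ 2 ∂ν).toReal := by
  have hint := integrable_variance hinv (hg.memLp 2 ν)
  have hfin := lintegral_spread_sq_lt_top hσ
  have h1 : ENNReal.ofReal (∫ x, Var[g; m.kernel x] ∂ν) ≤ L ^ 2 * ∫⁻ x, m.spread x ^ 2 ∂ν := by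
    rw [ofReal_integral_eq_lintegral_ofReal hint (ae_of_all _ fun x => variance_nonneg _ _),
      ← lintegral_const_mul' _ _ (by simp)]
    refine lintegral_mono fun x => ?_
    rw [spread_sq]
    exact hg.ofReal_variance_le _
  have h2 := (ENNReal.ofReal_le_iff_le_toReal (ENNReal.mul_ne_top (by simp) hfin.ne)).1 h1
  simpa using h2

/-- The n-th iterate is L(1 - κ)ⁿ-Lipschitz, so the variance lost at step n is at most L²σ²(1 -
κ)^{2n}; C is the sum of these losses. -/
theorem variance_iterate_averaging_le (hinv : m.kernel.Invariant ν) {κ : ℝ} (hκ : 0 < κ)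
    (hκ1 : κ ≤ 1) (hricci : m.RicciAtLeast κ) (hσ : m.averageSpread ν < ∞)
    {L : ℝ≥0} {g : X → ℝ} (hg : IsBoundedLipschitz L g) :
    ∃ C : ℝ, 0 ≤ C ∧ ∀ n, Var[(averaging m.kernel)^[n] g; ν] ≤ C * ((1 - κ) ^ 2) ^ n := by
  have hq : ((1 - κ).toNNReal : ℝ) = 1 - κ := Real.coe_toNNReal _ (by linarith)
  have hlt : (1 - κ) ^ 2 < 1 := by nlinarith
  have hne : Nonempty X := nonempty_of_isProbabilityMeasure ν
  obtain ⟨B, hB⟩ := hg.2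
  have hBn : ∀ n x, |(averaging m.kernel)^[n] g x| ≤ B := by
    intro n
    induction n with
    | zero => exact hB
    | succ n ih =>
      rw [Function.iterate_succ_apply']
      exact fun x => abs_averaging_le ih x
  have hlim : Tendsto (fun n => Var[(averaging m.kernel)^[n] g; ν]) atTop (𝓝 0) := by
    refine tendsto_variance_zero_of_lipschitz ν
      (fun n => (hricci.isBoundedLipschitz_iterate hg n).1) hBn ?_
    have h1 : (1 - κ).toNNReal < 1 := by
      rw [Real.toNNReal_lt_one]
      linarith
    simpa using (tendsto_pow_atTop_nhds_zero_of_lt_one (zero_le) h1).const_mul L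
  refine ⟨((L : ℝ) ^ 2 * (∫⁻ x, m.spread x ^ 2 ∂ν).toReal) / (1 - (1 - κ) ^ 2),
    div_nonneg (by positivity) (by linarith),
    le_of_sub_succ_le_geometric (sq_nonneg _) hlt hlim fun n => ?_⟩
  have hgn := hricci.isBoundedLipschitz_iterate hg n
  have h1 := variance_eq_variance_averaging_add hinv (hgn.memLp 2 ν)
  have h2 := integral_variance_le hinv hσ hgn
  rw [Function.iterate_succ_apply']
  rw [h1, add_sub_cancel_left]
  refine h2.trans (le_of_eq ?_)
  push_cast
  rw [hq, ← pow_mul, mul_pow, ← pow_mul, mul_comm 2 n]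
  ring

/-- In positive curvature, `M` contracts the `L²`-norm of mean zero functions by `1 - κ`. -/
theorem norm_averagingL2_centerL2_le (hinv : m.kernel.Invariant ν)
    (hrev : m.kernel.IsReversible ν) {κ : ℝ} (hκ : 0 < κ) (hκ1 : κ ≤ 1)
    (hricci : m.RicciAtLeast κ) (hσ : m.averageSpread ν < ∞) (f : Lp ℝ 2 ν) :
    ‖averagingL2 m.kernel ν hinv (centerL2 ν f)‖ ≤ (1 - κ) * ‖centerL2 ν f‖ := by
  have hclosed : IsClosed {f : Lp ℝ 2 ν |
      ‖averagingL2 m.kernel ν hinv (centerL2 ν f)‖ ≤ (1 - κ) * ‖centerL2 ν f‖} :=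
    isClosed_le (by fun_prop) (by fun_prop)
  -- The inequality to be extended does not involve C, so it passes to limits although C varies with
  -- g.
  refine (dense_boundedLipschitzL2 ν).induction (P := fun f =>
    ‖averagingL2 m.kernel ν hinv (centerL2 ν f)‖ ≤ (1 - κ) * ‖centerL2 ν f‖) ?_ hclosed f
  rintro f ⟨L, g, hg, hfg⟩
  obtain ⟨C, hC, hvar⟩ := variance_iterate_averaging_le hinv hκ hκ1 hricci hσ hg
  refine norm_apply_le_of_norm_pow_apply_le (inner_averagingL2_comm hinv hrev)
    (C := √C) (by linarith) fun n => ?_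
  rw [centerL2_pow_averagingL2]
  refine le_of_sq_le_sq ?_ (by have : 0 ≤ 1 - κ := by linarith
                               positivity)
  rw [norm_centerL2_sq, variance_congr (averagingL2_pow_ae_eq hinv hfg n), mul_pow,
    Real.sq_sqrt hC, ← pow_mul, mul_comm n, pow_mul]
  exact hvar n

end RandomWalk

/-! ### Spectrum, quotient by constants, one-point spaces -/

/-- If t is in the spectrum of Id - A then 1 - t is in that of A, hence at most ‖A‖ ≤ c. -/
theorem one_sub_le_of_mem_spectrum_neg_sub_id {E : Type*} [NormedAddCommGroup E] [NormedSpace ℝ E]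
    [CompleteSpace E] {A : E →L[ℝ] E} {c : ℝ} (hc : 0 ≤ c) (hA : ∀ x, ‖A x‖ ≤ c * ‖x‖) {t : ℝ}
    (ht : t ∈ spectrum ℝ (-(A - ContinuousLinearMap.id ℝ E))) : 1 - c ≤ t := by
  have hmem : 1 - t ∈ spectrum ℝ A := by
    rw [spectrum.mem_iff] at ht ⊢
    intro hu
    refine ht ?_
    have e : algebraMap ℝ (E →L[ℝ] E) t - -(A - ContinuousLinearMap.id ℝ E)
        = -(algebraMap ℝ (E →L[ℝ] E) (1 - t) - A) := by
      rw [map_sub, map_one, ← ContinuousLinearMap.one_def]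
      abel
    rw [e]
    exact hu.neg
  have h1 := spectrum.norm_le_norm_mul_of_mem hmem
  have h2 : ‖A‖ * ‖(1 : E →L[ℝ] E)‖ ≤ c * 1 := by
    gcongr
    · exact A.opNorm_le_bound hc hA
    · exact ContinuousLinearMap.norm_id_le
  have h3 := (le_abs_self _).trans (h1.trans h2)
  linarith

/-- Closedness makes the quotient seminorm a norm, as the spectral bound requires. -/
instance isClosed_constL2 {X : Type*} [MeasurableSpace X] (ν : Measure X) [IsFiniteMeasure ν] :
    IsClosed (constL2 ν : Set (Lp ℝ 2 ν)) := by
  have : FiniteDimensional ℝ (constL2 ν) := by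
    unfold constL2
    infer_instance
  exact (constL2 ν).closed_of_finiteDimensional

theorem constL2_eq_top {X : Type*} [MeasurableSpace X] [Subsingleton X] (ν : Measure X)
    [IsProbabilityMeasure ν] : constL2 ν = ⊤ := by
  obtain ⟨x₀⟩ := nonempty_of_isProbabilityMeasure ν
  refine eq_top_iff.2 fun f _ => ⟨f x₀, Lp.ext ?_⟩
  filter_upwards [Lp.coeFn_const (p := 2) (μ := ν) (f x₀)] with x hx
  rw [Subsingleton.elim x x₀] at hx ⊢
  exact hx

theorem variance_eq_zero_of_subsingleton {X : Type*} [MeasurableSpace X] [Subsingleton X]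
    (f : X → ℝ) (μ : Measure X) [IsProbabilityMeasure μ] : Var[f; μ] = 0 := by
  obtain ⟨x₀⟩ := nonempty_of_isProbabilityMeasure μ
  have : f = fun _ => f x₀ := funext fun x => by rw [Subsingleton.elim x x₀]
  rw [this, variance_eq_integral aemeasurable_const]
  simp

/-! ### Spectral gap and Poincaré inequalities -/

namespace RandomWalk

variable {X : Type*} [MetricSpace X] [MeasurableSpace X] [BorelSpace X]
  [SecondCountableTopology X] {m : RandomWalk X} {ν : Measure X} [IsProbabilityMeasure ν]

/-- Centering a representative does not change its class, so the contraction applies; then take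
representatives of nearly minimal norm. -/
theorem norm_averagingL2Const_le (hinv : m.kernel.Invariant ν)
    (hrev : m.kernel.IsReversible ν) {κ : ℝ} (hκ : 0 < κ) (hκ1 : κ ≤ 1)
    (hricci : m.RicciAtLeast κ) (hσ : m.averageSpread ν < ∞) (x : Lp ℝ 2 ν ⧸ constL2 ν) :
    ‖averagingL2Const m.kernel ν hinv x‖ ≤ (1 - κ) * ‖x‖ := by
  have hmk : ∀ f : Lp ℝ 2 ν,
      ‖averagingL2Const m.kernel ν hinv (Submodule.Quotient.mk f)‖ ≤ (1 - κ) * ‖f‖ := by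
    intro f
    have e : averagingL2Const m.kernel ν hinv (Submodule.Quotient.mk f)
        = Submodule.Quotient.mk (averagingL2 m.kernel ν hinv (centerL2 ν f)) := by
      change Submodule.Quotient.mk (averagingL2 m.kernel ν hinv f) = _
      rw [Submodule.Quotient.eq, centerL2_apply, map_sub, averagingL2_const, sub_sub_cancel]
      exact ⟨_, rfl⟩
    rw [e]
    refine (Submodule.Quotient.norm_mk_le _ _).trans
      ((norm_averagingL2_centerL2_le hinv hrev hκ hκ1 hricci hσ f).trans ?_)
    have h1 := norm_centerL2_le_norm f
    have h2 : 0 ≤ 1 - κ := by linarith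
    gcongr
  refine le_of_forall_pos_le_add fun ε hε => ?_
  obtain ⟨f, rfl, hf⟩ := Submodule.Quotient.norm_mk_lt x hε
  refine (hmk f).trans ?_
  nlinarith [norm_nonneg f]

theorem variance_averaging_le (hinv : m.kernel.Invariant ν)
    (hrev : m.kernel.IsReversible ν) {κ : ℝ} (hκ : 0 < κ) (hκ1 : κ ≤ 1)
    (hricci : m.RicciAtLeast κ) (hσ : m.averageSpread ν < ∞) {f : X → ℝ} (hf : MemLp f 2 ν) :
    Var[averaging m.kernel f; ν] ≤ (1 - κ) ^ 2 * Var[f; ν] := by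
  have h := norm_averagingL2_centerL2_le hinv hrev hκ hκ1 hricci hσ (hf.toLp f)
  have h2 := pow_le_pow_left₀ (norm_nonneg _) h 2
  rw [← centerL2_averagingL2, mul_pow, norm_centerL2_sq, norm_centerL2_sq,
    variance_congr hf.coeFn_toLp, variance_congr ((coeFn_averagingL2 hinv _).trans
      (averaging_congr hinv hf.coeFn_toLp))] at h2
  exact h2

/-- The constant comes from 1 - (1 - κ)² = κ(2 - κ). -/
theorem variance_le_integral_variance (hinv : m.kernel.Invariant ν)
    (hrev : m.kernel.IsReversible ν) {κ : ℝ} (hκ : 0 < κ) (hκ1 : κ ≤ 1)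
    (hricci : m.RicciAtLeast κ) (hσ : m.averageSpread ν < ∞) {f : X → ℝ} (hf : MemLp f 2 ν) :
    Var[f; ν] ≤ 1 / (κ * (2 - κ)) * ∫ x, Var[f; m.kernel x] ∂ν := by
  have h1 := variance_averaging_le hinv hrev hκ hκ1 hricci hσ hf
  have h2 := variance_eq_variance_averaging_add hinv hf
  have hpos : 0 < κ * (2 - κ) := mul_pos hκ (by linarith)
  rw [one_div, ← div_eq_inv_mul, le_div_iff₀ hpos]
  linarith

/-- The double integral is 2(Var f - cov(f, Mf)), and Cauchy–Schwarz with the contraction gives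
cov(f, Mf) ≤ (1 - κ) Var f. -/
theorem variance_le_integral_sq_sub (hinv : m.kernel.Invariant ν)
    (hrev : m.kernel.IsReversible ν) {κ : ℝ} (hκ : 0 < κ) (hκ1 : κ ≤ 1)
    (hricci : m.RicciAtLeast κ) (hσ : m.averageSpread ν < ∞) {f : X → ℝ} (hf : MemLp f 2 ν) :
    Var[f; ν] ≤ 1 / (2 * κ) * ∫ x, ∫ y, (f y - f x) ^ 2 ∂(m.kernel x) ∂ν := by
  have hMf := memLp_averaging hinv hf
  have hcov : cov[f, averaging m.kernel f; ν] ≤ (1 - κ) * Var[f; ν] := by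
    have h3 := real_inner_le_norm (centerL2 ν (hf.toLp f))
      (centerL2 ν (averagingL2 m.kernel ν hinv (hf.toLp f)))
    have h4 := norm_averagingL2_centerL2_le hinv hrev hκ hκ1 hricci hσ (hf.toLp f)
    rw [inner_centerL2, covariance_congr hf.coeFn_toLp ((coeFn_averagingL2 hinv _).trans
      (averaging_congr hinv hf.coeFn_toLp)), centerL2_averagingL2] at h3
    rw [← variance_congr hf.coeFn_toLp, ← norm_centerL2_sq]
    nlinarith [norm_nonneg (centerL2 ν (hf.toLp f))]
  have h2 : ∫ x, ∫ y, (f y - f x) ^ 2 ∂(m.kernel x) ∂ν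
      = 2 * (Var[f; ν] - cov[f, averaging m.kernel f; ν]) := by
    rw [integral_sq_sub_compProd hinv hf, variance_eq_sub hf, covariance_eq_sub hf hMf,
      integral_averaging hinv (hf.integrable one_le_two)]
    simp only [Pi.pow_apply, Pi.mul_apply]
    ring
  rw [one_div, ← div_eq_inv_mul, le_div_iff₀ (by positivity), h2]
  linarith

end RandomWalk

theorem corollary30 {X : Type*} [MetricSpace X] [CompleteSpace X]
    [SecondCountableTopology X] [MeasurableSpace X] [BorelSpace X]
    (m : RandomWalk X) (ν : Measure X) [IsProbabilityMeasure ν]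
    (hinv : m.kernel.Invariant ν) (hrev : m.kernel.IsReversible ν)
    (κ : ℝ) (hκ : 0 < κ) (hricci : m.RicciAtLeast κ) (hσ : m.averageSpread ν < ∞) :
    (∀ t ∈ spectrum ℝ (-laplacianL2Const m.kernel ν hinv), κ ≤ t) ∧
    ∀ f : X → ℝ, MemLp f 2 ν →
      ((∀ᵐ x ∂ν, MemLp f 2 (m.kernel x)) ∧
        Integrable (fun x => Var[f; m.kernel x]) ν ∧
        Var[f; ν] ≤ 1 / (κ * (2 - κ)) * ∫ x, Var[f; m.kernel x] ∂ν) ∧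
      (Integrable (fun p : X × X => (f p.2 - f p.1) ^ 2) (ν ⊗ₘ m.kernel) ∧
        Var[f; ν] ≤ 1 / (2 * κ) * ∫ x, ∫ y, (f y - f x) ^ 2 ∂(m.kernel x) ∂ν) := by
  rcases subsingleton_or_nontrivial X with hX | hX
  -- On one point κ ≤ 1 may fail, but the quotient is zero, so the spectrum is empty, and all
  -- variances vanish.
  · refine ⟨fun t ht => ?_, fun f hf => ⟨⟨ae_memLp_of_invariant hinv hf,
      integrable_variance hinv hf, ?_⟩, integrable_sq_sub_compProd hinv hf, ?_⟩⟩
    · have : Subsingleton (Lp ℝ 2 ν ⧸ constL2 ν) :=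
        Submodule.Quotient.subsingleton_iff.2 (constL2_eq_top ν)
      have : Subsingleton ((Lp ℝ 2 ν ⧸ constL2 ν) →L[ℝ] (Lp ℝ 2 ν ⧸ constL2 ν)) :=
        ContinuousLinearMap.uniqueOfLeft.instSubsingleton
      rw [spectrum.of_subsingleton] at ht
      exact ht.elim
    · simp [variance_eq_zero_of_subsingleton]
    · rw [variance_eq_zero_of_subsingleton]
      positivity
  · have hκ1 := hricci.le_one
    refine ⟨fun t ht => ?_, fun f hf => ⟨⟨ae_memLp_of_invariant hinv hf,
      integrable_variance hinv hf,
      RandomWalk.variance_le_integral_variance hinv hrev hκ hκ1 hricci hσ hf⟩,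
      integrable_sq_sub_compProd hinv hf,
      RandomWalk.variance_le_integral_sq_sub hinv hrev hκ hκ1 hricci hσ hf⟩⟩
    have := one_sub_le_of_mem_spectrum_neg_sub_id (sub_nonneg.2 hκ1)
      (RandomWalk.norm_averagingL2Const_le hinv hrev hκ hκ1 hricci hσ) ht
    linarith
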